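/- Let $G$ be a graph (finite or infinite, not necessarily connected) and let $W$ be a finite nonempty set of vertices of $G$. Then $G$ has a star decomposition $(S, Q_s \mid s\in V(S))$ of finite adhesion, with centre $c$, such that 1. every topological end of $G$ lives in some part $Q_s$ where $s$ is a leaf of $S$; 2. only the central part $Q_c$ contains vertices of $W$ (so $W\subseteq V(Q_c)$, and no leaf part contains a vertex of $W$); 3. for every leaf $s$, some topological end of $G$ lives in $Q_s$; 4. for every leaf $s$, the graph $Q_s\setminus Q_c$, that is, the subgraph of $G$ induced by $V(Q_s)\setminus V(Q_c)$, is connected (in particular nonempty). Here the following terminology is used. A *vertex end* of $G$ is an equivalence class of rays (one-way infinite paths), where two rays are equivalent if no finite set of vertices separates them in $G$. A vertex $v$ *dominates* a vertex end $\omega$ if for some ray $R$ belonging to $\omega$ there is an infinite set of $v$–$R$-paths that are pairwise vertex-disjoint except at $v$. A *topological end* is a vertex end that is dominated by no vertex. A *tree-decomposition* of $G$ consists of a tree $T$ and a family $(P_t\mid t\in V(T))$ of subgraphs of $G$ (the *parts*) such that every vertex of $G$ lies in at least one part, every edge of $G$ lies in precisely one part, and whenever a vertex lies in $P_t$ and in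 $P_w$, it lies in $P_u$ for every node $u$ on the $t$–$w$-path in $T$. It has *finite adhesion* if $V(P_t)\cap V(P_u)$ is finite for every edge $tu$ of $T$. It is a *star decomposition* with centre $c$ if $T$ is a star with centre $c$, that is, the edges of $T$ are exactly those joining $c$ to each other node; the *leaves* are the nodes other than $c$, and there may be any number of them, finite (including none) or infinite. For a directed edge $tu$ of $T$, let $X_{tu}$ be the set of the edges of $G$ contained in parts $P_w$ with $w$ in the component of $T-t$ that contains $u$. A vertex end $\omega$ *lives* in $X_{tu}$ if some ray belonging to $\omega$ has all its vertices incident with edges in $X_{tu}$. Finally, $\omega$ *lives* in the part $P_s$ if the directed edges $tu$ of $T$ such that $\omega$ lives in $X_{tu}$ are precisely those that point towards $s$, that is, those for which $s$ lies in the component of $T-t$ containing $u$. -/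

import Mathlib

universe u v

namespace EndTD

/-- A ray (one-way infinite path) in a graph. -/
structure Ray {V : Type u} (G : SimpleGraph V) where
  vert : ℕ → V
  inj : Function.Injective vert
  adj : ∀ n, G.Adj (vert n) (vert (n + 1))

/-- Two rays are equivalent if no finite vertex set separates them, that is, for every finite
vertex set `S` there is a walk in `G - S` from a vertex of `R` to a vertex of `R'`. -/
def Ray.Equivalent {V : Type u} {G : SimpleGraph V} (R R' : Ray G) : Prop :=
  ∀ S : Set V, S.Finite →
    ∃ (m n : ℕ) (p : G.Walk (R.vert m) (R'.vert n)), ∀ x ∈ p.support, x ∉ S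

theorem Ray.exists_walk {V : Type u} {G : SimpleGraph V} (R : Ray G) (N : ℕ) (i d : ℕ)
    (hi : N ≤ i) : ∃ p : G.Walk (R.vert i) (R.vert (i + d)),
      ∀ x ∈ p.support, ∃ k, N ≤ k ∧ x = R.vert k := by
  induction d with
  | zero => exact ⟨.nil, fun x hx => ⟨i, hi, by simpa using hx⟩⟩
  | succ d ih =>
    obtain ⟨p, hp⟩ := ih
    refine ⟨p.concat (R.adj (i + d)), fun x hx => ?_⟩
    rw [SimpleGraph.Walk.support_concat] at hx
    simp only [List.mem_append, List.mem_singleton] at hx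
    rcases hx with hx | hx
    · exact hp x hx
    · exact ⟨i + d + 1, by omega, hx⟩

theorem Ray.equivalent_trans {V : Type u} {G : SimpleGraph V} {R₁ R₂ R₃ : Ray G}
    (h : R₁.Equivalent R₂) (h' : R₂.Equivalent R₃) : R₁.Equivalent R₃ := by
  intro S hS
  obtain ⟨N, hN⟩ : ∃ N, ∀ k, N ≤ k → R₂.vert k ∉ S := by
    obtain ⟨M, hM⟩ := (hS.preimage R₂.inj.injOn).bddAbove
    exact ⟨M + 1, fun k hk hkS => by have := hM hkS; omega⟩
  have hS' : (S ∪ R₂.vert '' Set.Iio N).Finite := hS.union ((Set.finite_Iio N).image _)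
  obtain ⟨m, i, p, hp⟩ := h _ hS'
  obtain ⟨j, n, q, hq⟩ := h' _ hS'
  have hi : N ≤ i := by
    by_contra hlt
    exact hp _ p.end_mem_support (Or.inr ⟨i, not_le.1 hlt, rfl⟩)
  have hj : N ≤ j := by
    by_contra hlt
    exact hq _ q.start_mem_support (Or.inr ⟨j, not_le.1 hlt, rfl⟩)
  obtain ⟨r, hr⟩ : ∃ r : G.Walk (R₂.vert i) (R₂.vert j), ∀ x ∈ r.support, x ∉ S := by
    rcases le_total i j with hij | hij
    · obtain ⟨d, rfl⟩ := Nat.exists_eq_add_of_le hij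
      obtain ⟨r, hr⟩ := R₂.exists_walk N i d hi
      refine ⟨r, fun x hx => ?_⟩
      obtain ⟨k, hk, rfl⟩ := hr x hx
      exact hN k hk
    · obtain ⟨d, rfl⟩ := Nat.exists_eq_add_of_le hij
      obtain ⟨r, hr⟩ := R₂.exists_walk N j d hj
      refine ⟨r.reverse, fun x hx => ?_⟩
      obtain ⟨k, hk, rfl⟩ := hr x (by simpa using hx)
      exact hN k hk
  refine ⟨m, n, (p.append r).append q, fun x hx => ?_⟩
  simp only [SimpleGraph.Walk.mem_support_append_iff] at hx
  rcases hx with (hx | hx) | hx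
  · exact fun hxS => hp x hx (Or.inl hxS)
  · exact hr x hx
  · exact fun hxS => hq x hx (Or.inl hxS)

instance raySetoid {V : Type u} (G : SimpleGraph V) : Setoid (Ray G) where
  r := Ray.Equivalent
  iseqv :=
    { refl := fun R S hS => by
        obtain ⟨M, hM⟩ := (hS.preimage R.inj.injOn).bddAbove
        refine ⟨M + 1, M + 1, .nil, fun x hx hxS => ?_⟩
        obtain rfl : x = R.vert (M + 1) := by simpa using hx
        have := hM hxS
        omega
      symm := fun h S hS => by
        obtain ⟨m, n, p, hp⟩ := h S hS
        exact ⟨n, m, p.reverse, fun x hx => hp x (by simpa using hx)⟩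
      trans := Ray.equivalent_trans }

/-- The vertex ends of `G`: the equivalence classes of rays. -/
def VertexEnd {V : Type u} (G : SimpleGraph V) : Type u := Quotient (raySetoid G)

/-- The ray `R` belongs to the vertex end `ω`. -/
def Ray.BelongsTo {V : Type u} {G : SimpleGraph V} (R : Ray G) (ω : VertexEnd G) : Prop :=
  Quotient.mk (raySetoid G) R = ω

/-- The vertex `x` dominates `ω`: for some ray `R` belonging to `ω` there are infinitely many
`x`-`R`-paths (paths from `x` to a vertex of `R` that have only their last vertex in `R`),
pairwise disjoint except at `x`. -/
def Dominates {V : Type u} {G : SimpleGraph V} (x : V) (ω : VertexEnd G) : Prop :=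
  ∃ R : Ray G, R.BelongsTo ω ∧
    ∃ (n : ℕ → ℕ) (p : ∀ k, G.Walk x (R.vert (n k))),
      Function.Injective n ∧
      (∀ k, (p k).IsPath) ∧
      (∀ k i, R.vert i ∈ (p k).support → i = n k) ∧
      (∀ k l, k ≠ l → ∀ y, y ∈ (p k).support → y ∈ (p l).support → y = x)

/-- The topological ends of `G` are its undominated vertex ends. -/
def IsTopologicalEnd {V : Type u} {G : SimpleGraph V} (ω : VertexEnd G) : Prop :=
  ∀ x : V, ¬ Dominates x ω

/-- The set `V(X)` of the vertices incident with an edge in `X`. -/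
def vertsOf {V : Type u} (X : Set (Sym2 V)) : Set V := {x | ∃ e ∈ X, x ∈ e}

/-- The vertex end `ω` lives in the edge set (separation) `X`. -/
def LivesInSep {V : Type u} {G : SimpleGraph V} (ω : VertexEnd G) (X : Set (Sym2 V)) : Prop :=
  ∃ R : Ray G, R.BelongsTo ω ∧ ∀ n, R.vert n ∈ vertsOf X

/-- A tree-decomposition of `G` with decomposition tree on the node set `S`. Its parts are
subgraphs of `G`, and every edge of `G` lies in precisely one part. -/
structure TreeDecomposition {V : Type u} (G : SimpleGraph V) (S : Type v) where
  tree : SimpleGraph S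
  isTree : tree.IsTree
  part : S → G.Subgraph
  vertex_mem : ∀ x : V, ∃ t, x ∈ (part t).verts
  edge_mem : ∀ e ∈ G.edgeSet, ∃! t, e ∈ (part t).edgeSet
  mem_of_mem_path : ∀ (t w : S) (p : tree.Walk t w), p.IsPath → ∀ r ∈ p.support,
    ∀ x : V, x ∈ (part t).verts → x ∈ (part w).verts → x ∈ (part r).verts

namespace TreeDecomposition

variable {V : Type u} {G : SimpleGraph V} {S : Type v}

/-- Adjacent parts intersect only finitely. -/
def FiniteAdhesion (D : TreeDecomposition G S) : Prop :=
  ∀ t r, D.tree.Adj t r → ((D.part t).verts ∩ (D.part r).verts).Finite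

/-- The nodes of the component of `T - t` that contains `r` (for a directed edge `tr` of the
decomposition tree `T`). -/
def side (D : TreeDecomposition G S) (t r : S) : Set S :=
  {w | ∃ p : D.tree.Walk r w, t ∉ p.support}

/-- The separation corresponding to the directed edge `tr` of the decomposition tree. -/
def sep (D : TreeDecomposition G S) (t r : S) : Set (Sym2 V) :=
  {e | ∃ w ∈ D.side t r, e ∈ (D.part w).edgeSet}

/-- The set `O(ω)` of those directed edges of the decomposition tree in whose corresponding
separation `ω` lives. -/
def orientation (D : TreeDecomposition G S) (ω : VertexEnd G) : Set (S × S) :=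
  {a | D.tree.Adj a.1 a.2 ∧ LivesInSep ω (D.sep a.1 a.2)}

/-- The vertex end `ω` lives in the part of the node `s`: the orientation `O(ω)` points towards
`s`, that is, it consists of precisely those directed edges `tr` for which `s` lies in the
component of `T - t` that contains `r`. -/
def LivesInPart (D : TreeDecomposition G S) (ω : VertexEnd G) (s : S) : Prop :=
  D.orientation ω = {a | D.tree.Adj a.1 a.2 ∧ s ∈ D.side a.1 a.2}

/-- The tree-decomposition is a star decomposition with centre `c`: its decomposition tree is the
star in which `c` is adjacent to all other nodes. The leaves are the nodes different from `c`. -/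
def IsStar (D : TreeDecomposition G S) (c : S) : Prop :=
  D.tree = SimpleGraph.starGraph c

end TreeDecomposition

end EndTD

/-! Call a ray near a vertex set `A` if no finite vertex set separates it from `A`. Let `A` be the
closed neighbourhood of `W`. By `exists_envelope` it has a superset `E` that acquires no new near
rays and leaves only components with finite boundary. The leaf parts are the components of `G - E`
containing a ray of a topological end, each with its boundary; the centre is induced on the
complement of these components. No ray of a topological end is near `A`, since finitely many
vertices, none dominating, can be cut off together by a finite set (`IsTopologicalEnd.not_near`). So
no such ray is near `E`, and each has a tail in one component of `G - E`.

For the envelope, add to `A` a maximal set of disjoint rays near `A`, then all vertices not finitely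
separable from the result. If a component had infinite boundary, the star-comb lemma
`exists_mem_infLinked_or_exists_near` would give either a vertex of it that belongs to `E`, or a ray
in it near `A`, against maximality. -/

namespace EndTD

/-! ### Walks avoiding a vertex set, components and their boundaries. -/

section Linked

variable {V : Type u} {G : SimpleGraph V} {X Y : Set V} {a b c : V}

/-- Some walk from `a` to `b` avoids the vertex set `X`. -/
def Linked (G : SimpleGraph V) (X : Set V) (a b : V) : Prop :=
  ∃ p : G.Walk a b, ∀ x ∈ p.support, x ∉ X

theorem Linked.refl (h : a ∉ X) : Linked G X a a := ⟨.nil, by simpa using h⟩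

theorem Linked.symm (h : Linked G X a b) : Linked G X b a := by
  obtain ⟨p, hp⟩ := h
  exact ⟨p.reverse, fun x hx => hp x (by simpa using hx)⟩

theorem Linked.trans (h : Linked G X a b) (h' : Linked G X b c) : Linked G X a c := by
  obtain ⟨p, hp⟩ := h
  obtain ⟨q, hq⟩ := h'
  refine ⟨p.append q, fun x hx => ?_⟩
  rcases (SimpleGraph.Walk.mem_support_append_iff _ _).1 hx with hx | hx
  exacts [hp x hx, hq x hx]

theorem Linked.mono (hXY : X ⊆ Y) (h : Linked G Y a b) : Linked G X a b := by
  obtain ⟨p, hp⟩ := h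
  exact ⟨p, fun x hx hxX => hp x hx (hXY hxX)⟩

theorem Linked.left_notMem (h : Linked G X a b) : a ∉ X := by
  obtain ⟨p, hp⟩ := h
  exact hp a p.start_mem_support

theorem Linked.right_notMem (h : Linked G X a b) : b ∉ X := h.symm.left_notMem

theorem Linked.of_adj (h : G.Adj a b) (ha : a ∉ X) (hb : b ∉ X) : Linked G X a b :=
  ⟨.cons h .nil, by simp [ha, hb]⟩

/-- The vertices outside `C` with a neighbour in `C`. -/
def boundary (G : SimpleGraph V) (C : Set V) : Set V := {x | x ∉ C ∧ ∃ y ∈ C, G.Adj x y}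

/-- A walk leaving `C` does so through a boundary vertex. -/
theorem Linked.mem_of_disjoint_boundary {C : Set V} (hC : boundary G C ⊆ X)
    (h : Linked G X a b) (ha : a ∈ C) : b ∈ C := by
  obtain ⟨p, hp⟩ := h
  induction p with
  | nil => exact ha
  | @cons x y z hxy p ih =>
    refine ih ?_ fun t ht => hp t (by simp [ht])
    by_contra hy
    exact hp y (by simp) (hC ⟨hy, x, ha, hxy.symm⟩)

/-- The component of `G - X` that contains `a`. -/
def component (G : SimpleGraph V) (X : Set V) (a : V) : Set V := {b | Linked G X a b}

theorem boundary_component_subset : boundary G (component G X a) ⊆ X := by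
  rintro x ⟨hx, y, hy, hxy⟩
  by_contra hxX
  exact hx (hy.trans (.of_adj hxy.symm hy.right_notMem hxX))

theorem component_connected (ha : a ∉ X) : (G.induce (component G X a)).Connected := by
  have key : ∀ b (hb : b ∈ component G X a),
      (G.induce (component G X a)).Reachable ⟨a, .refl ha⟩ ⟨b, hb⟩ := by
    intro b hb
    obtain ⟨p, hp⟩ := id hb
    have hs : ∀ x ∈ p.support, x ∈ component G X a := fun x hx => by
      classical
      exact ⟨p.takeUntil x hx, fun y hy => hp y (p.support_takeUntil_subset_support hx hy)⟩
    exact ⟨p.induce _ hs⟩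
  have : Nonempty (component G X a) := ⟨⟨a, .refl ha⟩⟩
  exact ⟨fun x y => (key x x.2).symm.trans (key y y.2)⟩

end Linked

/-! ### Rays in the closure of a vertex set. -/

section Near

variable {V : Type u} {G : SimpleGraph V} {A B : Set V} {R R' : Ray G}

/-- No finite vertex set separates the ray `R` from the vertex set `A`. -/
def Near (R : Ray G) (A : Set V) : Prop :=
  ∀ X : Set V, X.Finite → ∃ i, ∃ x ∈ A, Linked G X (R.vert i) x

theorem Near.mono (hAB : A ⊆ B) (h : Near R A) : Near R B := fun X hX => by
  obtain ⟨i, x, hx, hl⟩ := h X hX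
  exact ⟨i, x, hAB hx, hl⟩

theorem Ray.linked_of_le (R : Ray G) {X : Set V} {i j : ℕ} (hij : i ≤ j)
    (h : ∀ k, i ≤ k → R.vert k ∉ X) : Linked G X (R.vert i) (R.vert j) := by
  obtain ⟨d, rfl⟩ := Nat.exists_eq_add_of_le hij
  obtain ⟨p, hp⟩ := R.exists_walk i i d le_rfl
  refine ⟨p, fun x hx => ?_⟩
  obtain ⟨k, hk, rfl⟩ := hp x hx
  exact h k hk

theorem Ray.exists_forall_notMem (R : Ray G) {X : Set V} (hX : X.Finite) :
    ∃ N, ∀ k, N ≤ k → R.vert k ∉ X := by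
  obtain ⟨M, hM⟩ := (hX.preimage R.inj.injOn).bddAbove
  exact ⟨M + 1, fun k hk hkS => by have := hM hkS; omega⟩

theorem Near.linked_of_tail (hR : Near R A) {X : Set V} (hX : X.Finite) {k : ℕ}
    (h : ∀ j, k ≤ j → R.vert j ∉ X) : ∃ x ∈ A, Linked G X (R.vert k) x := by
  -- Deleting the initial segment as well forces the link to start in the tail.
  obtain ⟨j, x, hx, hl⟩ := hR (X ∪ R.vert '' Set.Iio k) (hX.union ((Set.finite_Iio k).image _))
  have hj : k ≤ j := by
    by_contra hlt
    exact hl.left_notMem (Or.inr ⟨j, not_le.1 hlt, rfl⟩)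
  exact ⟨x, hx, (R.linked_of_le hj h).trans (hl.mono Set.subset_union_left)⟩

/-- The tail of a ray from its `k`-th vertex on. -/
def Ray.tail (R : Ray G) (k : ℕ) : Ray G where
  vert n := R.vert (n + k)
  inj m n h := by simpa using R.inj h
  adj n := by simpa [Nat.add_right_comm] using R.adj (n + k)

theorem Near.tail (h : Near R A) (k : ℕ) : Near (R.tail k) A := by
  intro X hX
  obtain ⟨N, hN⟩ := R.exists_forall_notMem hX
  obtain ⟨x, hx, hl⟩ := h.linked_of_tail hX (k := N + k) fun j hj => hN j (by omega)
  exact ⟨N, x, hx, hl⟩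

theorem Ray.tail_belongsTo {ω : VertexEnd G} (h : R.BelongsTo ω) (k : ℕ) :
    (R.tail k).BelongsTo ω := by
  refine (Quotient.sound ?_).trans h
  intro S hS
  obtain ⟨N, hN⟩ := R.exists_forall_notMem hS
  exact ⟨N, N + k, Linked.refl (G := G) (hN (N + k) (by omega))⟩

/-- Vertices on disjoint rays near `A` do not enlarge the closure of `A`. -/
theorem near_of_near_union_rays {𝓡 : Set (Ray G)} (h𝓡 : ∀ R ∈ 𝓡, Near R A)
    (hd : 𝓡.PairwiseDisjoint fun R => Set.range R.vert)
    (h : Near R (A ∪ ⋃ R ∈ 𝓡, Set.range R.vert)) : Near R A := by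
  intro X hX
  by_contra hcon
  push Not at hcon
  -- `F` consists of the initial segments, up to vertices of `X`, of rays in `𝓡`. It is finite
  -- because each vertex of `X` is on at most one of them. From a vertex outside `F`, the rest of
  -- its ray avoids `X` and can be followed towards `A`.
  let F : Set V := ⋃ x ∈ X, {v | ∃ R' ∈ 𝓡, ∃ j, R'.vert j = x ∧ ∃ k ≤ j, v = R'.vert k}
  have hF : F.Finite := by
    refine hX.biUnion fun x _ => ?_
    by_cases hx : ∃ R' ∈ 𝓡, ∃ j, R'.vert j = x
    · obtain ⟨R', hR', j, rfl⟩ := hx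
      refine ((Set.finite_Iic j).image R'.vert).subset ?_
      rintro v ⟨R'', hR'', j', hj', k, hk, rfl⟩
      obtain rfl : R'' = R' := by
        by_contra hne
        exact Set.disjoint_left.1 (hd hR'' hR' hne) ⟨j', rfl⟩ ⟨j, hj'.symm⟩
      exact ⟨k, by rw [← R''.inj hj']; exact hk, rfl⟩
    · refine Set.finite_empty.subset ?_
      rintro v ⟨R', hR', j, hj, -⟩
      exact hx ⟨R', hR', j, hj⟩
  obtain ⟨i, x, hx, hl⟩ := h (X ∪ F) (hX.union hF)
  have hlX := hl.mono (Set.subset_union_left : X ⊆ X ∪ F)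
  rcases hx with hx | hx
  · exact hcon i x hx hlX
  · simp only [Set.mem_iUnion, Set.mem_range] at hx
    obtain ⟨R', hR', k, rfl⟩ := hx
    by_cases hj : ∃ j, k ≤ j ∧ R'.vert j ∈ X
    · obtain ⟨j, hkj, hjX⟩ := hj
      exact hl.right_notMem (Or.inr (Set.mem_biUnion hjX ⟨R', hR', j, rfl, k, hkj, rfl⟩))
    · push Not at hj
      obtain ⟨y, hy, hly⟩ := (h𝓡 R' hR').linked_of_tail hX hj
      exact hcon i y hy (hlX.trans hly)

/-- The vertices that no finite set of other vertices separates from `A`. -/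
def infLinked (G : SimpleGraph V) (A : Set V) : Set V :=
  {v | ∀ X : Set V, X.Finite → v ∉ X → ∃ x ∈ A, Linked G X v x}

theorem subset_infLinked : A ⊆ infLinked G A := fun v hv _ _ hvX => ⟨v, hv, .refl hvX⟩

theorem infLinked_infLinked_subset : infLinked G (infLinked G A) ⊆ infLinked G A := by
  intro v hv X hX hvX
  obtain ⟨x, hx, hl⟩ := hv X hX hvX
  obtain ⟨y, hy, hl'⟩ := hx X hX hl.right_notMem
  exact ⟨y, hy, hl.trans hl'⟩

theorem infLinked_mono (hAB : A ⊆ B) : infLinked G A ⊆ infLinked G B := by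
  intro v hv X hX hvX
  obtain ⟨x, hx, hl⟩ := hv X hX hvX
  exact ⟨x, hAB hx, hl⟩

theorem near_of_near_infLinked (h : Near R (infLinked G A)) : Near R A := by
  intro X hX
  obtain ⟨i, x, hx, hl⟩ := h X hX
  obtain ⟨y, hy, hl'⟩ := hx X hX hl.right_notMem
  exact ⟨i, y, hy, hl.trans hl'⟩

end Near

/-! ### Geodesics and the star-comb lemma. -/

section Geodesic

variable {U : Type u} {H : SimpleGraph U}

theorem dist_add_dist_of_mem_geodesic {a b z : U} (p : H.Walk a b) (hp : p.length = H.dist a b)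
    (hz : z ∈ p.support) (hH : H.Connected) : H.dist a z + H.dist z b = H.dist a b := by
  classical
  have h1 := SimpleGraph.dist_le (p.takeUntil z hz)
  have h2 := SimpleGraph.dist_le (p.dropUntil z hz)
  have h3 := congrArg SimpleGraph.Walk.length (p.take_spec hz)
  rw [SimpleGraph.Walk.length_append] at h3
  have := hH.dist_triangle (u := a) (v := z) (w := b)
  omega

theorem exists_adj_dist_add_one (hH : H.Connected) {a b : U} (hab : a ≠ b) :
    ∃ y, H.Adj a y ∧ H.dist y b + 1 = H.dist a b := by
  obtain ⟨p, hp⟩ := hH.exists_walk_length_eq_dist a b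
  cases p with
  | nil => exact absurd rfl hab
  | @cons _ y _ h q =>
    refine ⟨y, h, ?_⟩
    have h1 := SimpleGraph.dist_le q
    have h2 := hH.dist_triangle (u := a) (v := y) (w := b)
    rw [SimpleGraph.dist_eq_one_iff_adj.2 h] at h2
    rw [SimpleGraph.Walk.length_cons] at hp
    omega

end Geodesic

variable {V : Type u} {G : SimpleGraph V}

/-- A star-comb lemma: if infinitely many vertices send an edge to the connected set `C`, then some
vertex of `C` cannot be separated from them by finitely many other vertices, or some ray in `C`
cannot be separated from them by finitely many vertices. -/
theorem exists_mem_infLinked_or_exists_near {C N : Set V} (hC : (G.induce C).Connected)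
    (hN : N.Infinite) (hadj : ∀ x ∈ N, ∃ y ∈ C, G.Adj x y) :
    (∃ d ∈ C, d ∈ infLinked G N) ∨ ∃ R : Ray G, (∀ n, R.vert n ∈ C) ∧ Near R N := by
  classical
  set H := G.induce C
  have hadj' : ∀ x : N, ∃ y : C, G.Adj x y := fun x => by
    obtain ⟨y, hy, h⟩ := hadj x x.2
    exact ⟨⟨y, hy⟩, h⟩
  choose f hf using hadj'
  obtain ⟨r⟩ := hC.nonempty
  -- `B x` collects the `u` for which `x` lies on a geodesic from the root `r` to the attachment
  -- vertex `f u`.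
  let B : C → Set N := fun x => {u | H.dist r x + H.dist x (f u) = H.dist r (f u)}
  have tri := fun a b c : C => hC.dist_triangle (u := a) (v := b) (w := c)
  have hlink : ∀ (X : Set V) (x : C) (u : N), u ∈ B x → (u : V) ∉ X →
      (∀ z : C, (z : V) ∈ X → H.dist r z = H.dist r x + H.dist x z → u ∉ B z) →
      Linked G X x u := by
    intro X x u hu huX hX
    obtain ⟨p, hp⟩ := hC.exists_walk_length_eq_dist x (f u)
    have hl : Linked G X x (f u) := by
      let e : H →g G := (SimpleGraph.Embedding.induce C).toHom
      refine ⟨p.map e, fun v hv hvX => ?_⟩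
      have hv' : v ∈ (p.map e).support := hv
      rw [SimpleGraph.Walk.support_map, List.mem_map] at hv'
      obtain ⟨z, hz, rfl⟩ := hv'
      have h1 := dist_add_dist_of_mem_geodesic p hp hz hC
      have h2 := tri r x z
      have h3 := tri r z (f u)
      simp only [B, Set.mem_ofPred_eq] at hu hX
      refine hX z hvX ?_ ?_ <;> omega
    exact hl.trans (.of_adj (hf u).symm hl.right_notMem huX)
  -- Either infinite `B x` can always be pushed one level outwards, which builds a geodesic ray, or
  -- it gets stuck at some `x`, the centre of an infinite star.
  by_cases hstep : ∀ x, (B x).Infinite → ∃ y, H.Adj x y ∧ H.dist r y = H.dist r x + 1 ∧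
      (B y).Infinite
  · right
    have hr : (B r).Infinite := by
      have : B r = Set.univ := by ext u; simp [B]
      rw [this]
      have := hN.to_subtype
      exact Set.infinite_univ
    choose! g hg using hstep
    let s : ℕ → C := fun n => g^[n] r
    have hs : ∀ n, (B (s n)).Infinite := by
      intro n
      induction n with
      | zero => exact hr
      | succ n ih =>
        simp only [s, Function.iterate_succ_apply'] at ih ⊢
        exact (hg _ ih).2.2
    have hsucc : ∀ n, s (n + 1) = g (s n) := fun n => Function.iterate_succ_apply' g n r
    have hd : ∀ n, H.dist r (s n) = n := by
      intro n
      induction n with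
      | zero => simp [s]
      | succ n ih => rw [hsucc, (hg _ (hs n)).2.1, ih]
    refine ⟨⟨fun n => s n, fun m n h => ?_, fun n => ?_⟩, fun n => (s n).2, fun X hX => ?_⟩
    · rw [← hd m, ← hd n, Subtype.ext h]
    · have := (hg _ (hs n)).1
      rw [← hsucc] at this
      exact this
    · obtain ⟨M, hM⟩ := ((hX.preimage (Subtype.val_injective (p := (· ∈ C))).injOn).image
        (H.dist r)).bddAbove
      have hfin : (Subtype.val ⁻¹' X : Set N).Finite := hX.preimage Subtype.val_injective.injOn
      -- All vertices of `X` in `C` are at distance at most `M` from `r`, so geodesics continuing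
      -- outwards from level `M + 1` avoid `X`.
      obtain ⟨u, hu, huX⟩ := ((hs (M + 1)).sdiff hfin).nonempty
      refine ⟨M + 1, u, u.2, hlink X _ u hu huX fun z hz hzd => ?_⟩
      have h1 : H.dist r z ≤ M := hM ⟨z, hz, rfl⟩
      rw [hd] at hzd
      omega
  · left
    push Not at hstep
    obtain ⟨x, hx, hfin⟩ := hstep
    refine ⟨x, x.2, fun X hX hxX => ?_⟩
    have hXC : (Subtype.val ⁻¹' X : Set C).Finite := hX.preimage Subtype.val_injective.injOn
    let Z : Set C := {z | (z : V) ∈ X ∧ H.dist r z = H.dist r x + H.dist x z}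
    have hZ : Z.Finite := hXC.subset fun z hz => hz.1
    -- If `y` is the first step from `x` towards `z`, then `B z ⊆ B y`, and `B y` is finite by the
    -- choice of `x`.
    have hBz : ∀ z ∈ Z, (B z).Finite := by
      rintro z ⟨hzX, hz⟩
      have hne : x ≠ z := fun h => hxX (h ▸ hzX)
      obtain ⟨y, hxy, hy⟩ := exists_adj_dist_add_one hC hne
      have h1 := SimpleGraph.dist_eq_one_iff_adj.2 hxy
      have h2 := tri r x y
      have h3 := tri r y z
      refine (hfin y hxy (by omega)).subset fun u hu => ?_
      have h4 := tri y z (f u)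
      have h5 := tri r y (f u)
      simp only [B, Set.mem_ofPred_eq] at hu ⊢
      omega
    have hfin' : (Subtype.val ⁻¹' X : Set N).Finite := hX.preimage Subtype.val_injective.injOn
    obtain ⟨u, hu, huX⟩ := (hx.sdiff (hfin'.union (hZ.biUnion hBz))).nonempty
    simp only [Set.mem_union, Set.mem_iUnion, not_or, not_exists] at huX
    exact ⟨u, u.2, hlink X x u hu huX.1 fun z hz hzd => huX.2 z ⟨hz, hzd⟩⟩

/-! ### Existence of envelopes. -/

/-- Every vertex set `A` has an envelope: a superset that leaves only components with finite
boundary and has the same rays in its closure. -/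
theorem exists_envelope (A : Set V) : ∃ E : Set V, A ⊆ E ∧
    (∀ R : Ray G, Near R E → Near R A) ∧
    ∀ a, a ∉ E → (boundary G (component G E a)).Finite := by
  obtain ⟨𝓡, h𝓡⟩ := zorn_subset
    {𝓡 : Set (Ray G) | (∀ R ∈ 𝓡, Near R A) ∧ 𝓡.PairwiseDisjoint fun R => Set.range R.vert}
    (by
      intro c hc hchain
      refine ⟨⋃₀ c, ⟨fun R hR => ?_, ?_⟩, fun s hs => Set.subset_sUnion_of_mem hs⟩
      · obtain ⟨s, hs, hR⟩ := hR
        exact (hc hs).1 R hR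
      · exact (Set.pairwiseDisjoint_sUnion hchain.directedOn).2 fun s hs => (hc hs).2)
  obtain ⟨hnear, hdisj⟩ := h𝓡.prop
  set A' := A ∪ ⋃ R ∈ 𝓡, Set.range R.vert
  have hE : ∀ R : Ray G, Near R (infLinked G A') → Near R A := fun R hR =>
    near_of_near_union_rays hnear hdisj (near_of_near_infLinked hR)
  refine ⟨infLinked G A', Set.subset_union_left.trans subset_infLinked, hE, fun a ha => ?_⟩
  by_contra hinf
  rcases exists_mem_infLinked_or_exists_near (component_connected ha) hinf
    (fun x hx => hx.2) with ⟨d, hd, hd'⟩ | ⟨R, hR, hRN⟩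
  · exact hd.right_notMem (infLinked_infLinked_subset
      (infLinked_mono boundary_component_subset hd'))
  · have hRA := hE R (hRN.mono boundary_component_subset)
    have hRd : ∀ n, R.vert n ∉ A' := fun n hn => (hR n).right_notMem (subset_infLinked hn)
    -- `R` is near `A` and disjoint from all rays in `𝓡`, so maximality puts it in `𝓡`; but then its
    -- vertices lie in `A'`.
    have hmem : R ∈ 𝓡 := by
      refine h𝓡.le_of_ge (y := insert R 𝓡) ⟨?_, ?_⟩ (Set.subset_insert _ _)
        (Set.mem_insert _ _)
      · rintro R' (rfl | hR')
        exacts [hRA, hnear R' hR']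
      · refine hdisj.insert fun R' hR' _ => Set.disjoint_left.2 ?_
        rintro _ ⟨n, rfl⟩ hn
        exact hRd n (Or.inr (Set.mem_biUnion hR' hn))
    exact hRd 0 (Or.inr (Set.mem_biUnion hmem ⟨0, rfl⟩))

variable {V : Type u} {G : SimpleGraph V}

/-! ### Domination and undominated ends. -/

section Domination

/-- A shortest walk from `w` to `R` avoiding `X` cannot meet `R` before its end. -/
theorem exists_path_of_linked {R : Ray G} {w : V} {X : Set V} {i : ℕ}
    (h : Linked G X w (R.vert i)) : ∃ (n : ℕ) (p : G.Walk w (R.vert n)), p.IsPath ∧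
      (∀ x ∈ p.support, x ∉ X) ∧ ∀ j, R.vert j ∈ p.support → j = n := by
  classical
  have hex : ∃ l n, ∃ p : G.Walk w (R.vert n), (∀ x ∈ p.support, x ∉ X) ∧ p.length = l := by
    obtain ⟨p, hp⟩ := h
    exact ⟨p.length, i, p, hp, rfl⟩
  obtain ⟨n, p, hp, hl⟩ := Nat.find_spec hex
  have hb : ∀ x ∈ p.bypass.support, x ∉ X := fun x hx =>
    hp x (p.support_bypass_subset_support hx)
  refine ⟨n, p.bypass, p.bypass_isPath, hb, fun j hj => ?_⟩
  by_contra hne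
  have h1 := p.bypass.length_takeUntil_lt_length hj (fun h => hne (R.inj h))
  have h2 := p.length_bypass_le_length
  exact Nat.find_min hex (by omega) ⟨j, p.bypass.takeUntil _ hj,
    fun x hx => hb x (p.bypass.support_takeUntil_subset_support hj hx), rfl⟩

/-- A vertex that no finite set of other vertices separates from a ray avoiding it dominates the
end of this ray. -/
theorem dominates_of_forall_linked {R : Ray G} {ω : VertexEnd G} (hR : R.BelongsTo ω) {w : V}
    (hw : ∀ n, R.vert n ≠ w)
    (h : ∀ X : Set V, X.Finite → w ∉ X → ∃ i, Linked G X w (R.vert i)) : Dominates w ω := by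
  have hex : ∀ X : {X : Set V // X.Finite ∧ w ∉ X}, ∃ (n : ℕ) (p : G.Walk w (R.vert n)),
      p.IsPath ∧ (∀ x ∈ p.support, x ∉ X.1) ∧ ∀ j, R.vert j ∈ p.support → j = n := fun X => by
    obtain ⟨i, hi⟩ := h X.1 X.2.1 X.2.2
    exact exists_path_of_linked hi
  choose n p hp hpX hpR using hex
  -- The forbidden set grows by the previous path without `w`, so later paths meet earlier ones only
  -- in `w`.
  let s : ℕ → {X : Set V // X.Finite ∧ w ∉ X} := fun k => Nat.rec ⟨∅, Set.finite_empty, id⟩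
    (fun _ X => ⟨X.1 ∪ ({x | x ∈ (p X).support} \ {w}),
      X.2.1.union ((List.finite_toSet _).subset Set.sdiff_subset),
      by rintro (hX | hX); exacts [X.2.2 hX, hX.2 rfl]⟩) k
  have hmono : Monotone fun k => (s k).1 := monotone_nat_of_le_succ fun k =>
    Set.subset_union_left
  have hlt : ∀ k l, k < l → ∀ y, y ∈ (p (s k)).support → y ∈ (p (s l)).support → y = w := by
    intro k l hkl y hy hy'
    by_contra hyw
    exact hpX _ y hy' (hmono (Nat.succ_le_of_lt hkl) (Or.inr ⟨hy, hyw⟩))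
  have hdisj : ∀ k l, k ≠ l → ∀ y, y ∈ (p (s k)).support → y ∈ (p (s l)).support → y = w := by
    intro k l hkl y hy hy'
    rcases hkl.lt_or_gt with hkl | hkl
    exacts [hlt k l hkl y hy hy', hlt l k hkl y hy' hy]
  refine ⟨R, hR, fun k => n (s k), fun k => p (s k), fun k l hkl => ?_, fun k => hp _,
    fun k i hi => hpR _ i hi, hdisj⟩
  by_contra hne
  refine hw _ (hdisj k l hne _ (p (s k)).end_mem_support ?_)
  simp only at hkl
  rw [hkl]
  exact (p (s l)).end_mem_support

/-- The rays of an undominated end are not in the closure of the closed neighbourhood of a finite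
vertex set. -/
theorem IsTopologicalEnd.not_near {ω : VertexEnd G} (hω : IsTopologicalEnd ω) {R : Ray G}
    (hR : R.BelongsTo ω) {W : Set V} (hW : W.Finite) :
    ¬ Near R {x | ∃ w ∈ W, x = w ∨ G.Adj x w} := by
  intro hnear
  obtain ⟨N, hN⟩ := R.exists_forall_notMem hW
  have hsep : ∀ w ∈ W, ∃ X : Set V, X.Finite ∧ w ∉ X ∧
      ∀ i, ¬ Linked G X w ((R.tail N).vert i) := by
    intro w hw
    by_contra hcon
    push Not at hcon
    refine hω w (dominates_of_forall_linked (Ray.tail_belongsTo hR N) (fun n hn => ?_) hcon)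
    exact hN (n + N) (by omega) (by rw [← hn] at hw; exact hw)
  choose! X hX hwX hsX using hsep
  obtain ⟨i, x, ⟨w, hw, hxw⟩, hl⟩ := hnear.tail N (⋃ w ∈ W, X w) (hW.biUnion hX)
  -- Only `X w` is kept: `w` may lie in the sets chosen for other vertices of `W`, but not in its
  -- own.
  have hl' := hl.mono (Set.subset_biUnion_of_mem hw)
  rcases hxw with rfl | hxw
  · exact hsX x hw i hl'.symm
  · exact hsX w hw i (hl'.trans (.of_adj hxw hl'.right_notMem (hwX w hw))).symm

end Domination

/-! ### Star decompositions from disjoint, mutually non-adjacent vertex sets. -/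

section Star

theorem eq_or_eq_or_eq_of_mem_support_star {S : Type v} {c t w r : S}
    (p : (SimpleGraph.starGraph c).Walk t w) (hp : p.IsPath) (hr : r ∈ p.support) :
    r = t ∨ r = w ∨ r = c := by
  cases p with
  | nil => left; simpa using hr
  | @cons _ b _ h q =>
    cases q with
    | nil => simp at hr; tauto
    | @cons _ d _ h' q' =>
      have h1 := SimpleGraph.starGraph_adj.1 h
      have h2 := SimpleGraph.starGraph_adj.1 h'
      have hnd := hp.support_nodup
      cases q' with
      | nil =>
        simp at hnd hr
        grind
      | @cons _ e _ h'' q'' =>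
        have h3 := SimpleGraph.starGraph_adj.1 h''
        have he := q''.start_mem_support
        simp at hnd
        grind

variable {𝒞 : Set (Set V)}

/-- The part of the star decomposition whose leaves are the sets in `𝒞`. -/
def starPart (G : SimpleGraph V) (𝒞 : Set (Set V)) : Option 𝒞 → G.Subgraph
  | none =>
    { verts := (⋃₀ 𝒞)ᶜ
      Adj := fun a b => G.Adj a b ∧ a ∉ ⋃₀ 𝒞 ∧ b ∉ ⋃₀ 𝒞
      adj_sub := fun h => h.1
      edge_vert := fun h => h.2.1
      symm := ⟨fun _ _ h => ⟨h.1.symm, h.2.2, h.2.1⟩⟩ }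
  | some C =>
    { verts := C ∪ boundary G C
      -- Edges inside the boundary are left to the centre, so that no edge lies in two parts.
      Adj := fun a b => G.Adj a b ∧ (a ∈ C.1 ∨ b ∈ C.1)
      adj_sub := fun h => h.1
      edge_vert := fun {a b} h => by
        by_cases ha : a ∈ C.1
        · exact Or.inl ha
        · exact Or.inr ⟨ha, b, h.2.resolve_left ha, h.1⟩
      symm := ⟨fun _ _ h => ⟨h.1.symm, h.2.symm⟩⟩ }

theorem notMem_of_mem_of_boundary_disjoint (hd : 𝒞.PairwiseDisjoint id)
    (hb : ∀ C ∈ 𝒞, Disjoint (boundary G C) (⋃₀ 𝒞)) {C D : 𝒞} (hne : C ≠ D) {x : V}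
    (hx : x ∈ C.1) : x ∉ D.1 ∪ boundary G D := by
  rintro (hxD | hxD)
  · exact Set.disjoint_left.1 (hd C.2 D.2 (Subtype.coe_injective.ne hne)) hx hxD
  · exact Set.disjoint_left.1 (hb D D.2) hxD ⟨C, C.2, hx⟩

/-- The star decomposition whose leaves are pairwise disjoint vertex sets with no edges between
them. -/
def starDecomposition (G : SimpleGraph V) (𝒞 : Set (Set V)) (hd : 𝒞.PairwiseDisjoint id)
    (hb : ∀ C ∈ 𝒞, Disjoint (boundary G C) (⋃₀ 𝒞)) : TreeDecomposition G (Option 𝒞) where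
  tree := SimpleGraph.starGraph none
  isTree := SimpleGraph.isTree_starGraph none
  part := starPart G 𝒞
  vertex_mem x := by
    by_cases hx : x ∈ ⋃₀ 𝒞
    · obtain ⟨C, hC, hx⟩ := hx
      exact ⟨some ⟨C, hC⟩, Or.inl hx⟩
    · exact ⟨none, hx⟩
  edge_mem e := by
    induction e with
    | h a b =>
      intro hab
      have key : ∀ C : 𝒞, (a ∈ C.1 ∨ b ∈ C.1) →
          ∃! t, s(a, b) ∈ (starPart G 𝒞 t).edgeSet := by
        intro C hC
        refine ⟨some C, ⟨hab, hC⟩, ?_⟩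
        rintro (_ | D) hD
        · obtain ⟨-, ha, hb⟩ := hD
          rcases hC with h | h
          exacts [(ha ⟨C, C.2, h⟩).elim, (hb ⟨C, C.2, h⟩).elim]
        · by_contra hne
          have hne' : C ≠ D := fun h => hne (h ▸ rfl)
          have hDa : a ∈ D.1 ∪ boundary G D := (starPart G 𝒞 (some D)).edge_vert hD
          have hDb : b ∈ D.1 ∪ boundary G D := (starPart G 𝒞 (some D)).edge_vert hD.symm
          rcases hC with h | h
          exacts [notMem_of_mem_of_boundary_disjoint hd hb hne' h hDa,
            notMem_of_mem_of_boundary_disjoint hd hb hne' h hDb]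
      by_cases ha : a ∈ ⋃₀ 𝒞
      · obtain ⟨C, hC, ha⟩ := ha
        exact key ⟨C, hC⟩ (Or.inl ha)
      by_cases hb : b ∈ ⋃₀ 𝒞
      · obtain ⟨C, hC, hb⟩ := hb
        exact key ⟨C, hC⟩ (Or.inr hb)
      refine ⟨none, ⟨hab, ha, hb⟩, ?_⟩
      rintro (_ | D) hD
      · rfl
      · rcases hD.2 with h | h
        exacts [(ha ⟨D, D.2, h⟩).elim, (hb ⟨D, D.2, h⟩).elim]
  mem_of_mem_path t w p hp r hr x hxt hxw := by
    by_cases htw : t = w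
    · subst htw
      rw [SimpleGraph.Walk.nil_iff_support_eq.1 (SimpleGraph.Walk.isPath_iff_nil.1 hp)] at hr
      obtain rfl : r = t := by simpa using hr
      exact hxt
    rcases eq_or_eq_or_eq_of_mem_support_star p hp hr with rfl | rfl | rfl
    · exact hxt
    · exact hxw
    · rintro ⟨C, hC, hxC⟩
      have key : ∀ t, x ∈ (starPart G 𝒞 t).verts → t = some ⟨C, hC⟩ := by
        rintro (_ | D) h
        · exact (h ⟨C, hC, hxC⟩).elim
        · by_contra hne
          exact notMem_of_mem_of_boundary_disjoint hd hb (C := ⟨C, hC⟩) (D := D)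
            (fun h => hne (h ▸ rfl)) hxC h
      exact htw ((key t hxt).trans (key w hxw).symm)

section StarDecomposition

variable (hd : 𝒞.PairwiseDisjoint id) (hb : ∀ C ∈ 𝒞, Disjoint (boundary G C) (⋃₀ 𝒞))

theorem starDecomposition_side_none (C : 𝒞) :
    (starDecomposition G 𝒞 hd hb).side none (some C) = {some C} := by
  ext w
  constructor
  · rintro ⟨p, hp⟩
    cases p with
    | nil => rfl
    | @cons _ b _ h q =>
      obtain rfl : b = none := by
        have h' : (SimpleGraph.starGraph (none : Option 𝒞)).Adj (some C) b := h
        simpa using (SimpleGraph.starGraph_adj.1 h').2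
      simp at hp
  · rintro rfl
    exact ⟨.nil, by simp⟩

theorem starDecomposition_side_some (C : 𝒞) :
    (starDecomposition G 𝒞 hd hb).side (some C) none = {some C}ᶜ := by
  ext w
  constructor
  · rintro ⟨p, hp⟩ rfl
    exact hp p.end_mem_support
  · intro hw
    have hw' : some C ≠ w := fun h => hw h.symm
    cases w with
    | none => exact ⟨.nil, by simp⟩
    | some D =>
      have hadj : (starDecomposition G 𝒞 hd hb).tree.Adj none (some D) :=
        SimpleGraph.starGraph_center_adj (by simp)
      exact ⟨.cons hadj .nil, by simpa using hw'⟩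

/-- Since the boundary of `C` is finite, every ray of `ω` meets `C`, so `ω` lives in no separation
pointing away from `C`. The ray `R` itself witnesses every separation pointing towards `C`. -/
theorem starDecomposition_livesInPart {ω : VertexEnd G} {R : Ray G} (hR : R.BelongsTo ω) (C : 𝒞)
    (hfin : (boundary G C).Finite) (hRC : ∀ n, R.vert n ∈ C.1) :
    (starDecomposition G 𝒞 hd hb).LivesInPart ω (some C) := by
  have hmeet : ∀ R' : Ray G, R'.BelongsTo ω → ∃ n, R'.vert n ∈ C.1 := by
    intro R' hR'
    have heq : Ray.Equivalent R R' := Quotient.exact (hR.trans hR'.symm)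
    obtain ⟨m, n, hl⟩ := heq _ hfin
    exact ⟨n, Linked.mem_of_disjoint_boundary (G := G) subset_rfl hl (hRC m)⟩
  have hedge : ∀ n, s(R.vert n, R.vert (n + 1)) ∈
      ((starDecomposition G 𝒞 hd hb).part (some C)).edgeSet := fun n =>
    ⟨R.adj n, Or.inl (hRC n)⟩
  have hleaf : ∀ D : 𝒞, LivesInSep ω ((starDecomposition G 𝒞 hd hb).sep none (some D)) ↔
      C = D := by
    intro D
    simp only [TreeDecomposition.sep, starDecomposition_side_none, Set.mem_singleton_iff,
      exists_eq_left]
    constructor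
    · rintro ⟨R', hR', hv⟩
      obtain ⟨n, hn⟩ := hmeet R' hR'
      obtain ⟨e, he, hne⟩ := hv n
      by_contra hCD
      exact notMem_of_mem_of_boundary_disjoint hd hb hCD hn
        (SimpleGraph.Subgraph.mem_verts_of_mem_edge he hne)
    · rintro rfl
      exact ⟨R, hR, fun n => ⟨_, hedge n, Sym2.mem_mk_left _ _⟩⟩
  have hcentre : ∀ D : 𝒞, LivesInSep ω ((starDecomposition G 𝒞 hd hb).sep (some D) none) ↔
      C ≠ D := by
    intro D
    simp only [TreeDecomposition.sep, starDecomposition_side_some, Set.mem_compl_iff,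
      Set.mem_singleton_iff]
    constructor
    · rintro ⟨R', hR', hv⟩ rfl
      obtain ⟨n, hn⟩ := hmeet R' hR'
      obtain ⟨e, ⟨w, hw, he⟩, hne⟩ := hv n
      have hx := SimpleGraph.Subgraph.mem_verts_of_mem_edge he hne
      cases w with
      | none => exact hx ⟨C, C.2, hn⟩
      | some D =>
        exact notMem_of_mem_of_boundary_disjoint hd hb (fun h => hw (congrArg some h.symm)) hn hx
    · intro hCD
      exact ⟨R, hR, fun n => ⟨_, ⟨some C, fun h => hCD (Option.some.inj h), hedge n⟩,
        Sym2.mem_mk_left _ _⟩⟩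
  ext ⟨t, r⟩
  refine and_congr_right fun hadj => ?_
  have hadj' : (SimpleGraph.starGraph (none : Option 𝒞)).Adj t r := hadj
  rw [SimpleGraph.starGraph_adj] at hadj'
  cases t with
  | none =>
    cases r with
    | none => exact (hadj'.1 rfl).elim
    | some D =>
      simp only [starDecomposition_side_none]
      simpa using hleaf D
  | some D =>
    obtain rfl : r = none := by simpa using hadj'.2
    simp only [starDecomposition_side_some]
    simpa using hcentre D

end StarDecomposition

end Star

end EndTD

/-! ### The star decomposition separating `W` from the topological ends. -/

open EndTD in
theorem mainTheorem5 {V : Type u} (G : SimpleGraph V) (W : Set V) (hWfin : W.Finite)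
    (hW : W.Nonempty) :
    ∃ (S : Type u) (c : S) (Q : EndTD.TreeDecomposition G S),
      Q.IsStar c ∧
      Q.FiniteAdhesion ∧
      (∀ ω : EndTD.VertexEnd G, EndTD.IsTopologicalEnd ω → ∃ s, s ≠ c ∧ Q.LivesInPart ω s) ∧
      (∀ w ∈ W, ∀ t, w ∈ (Q.part t).verts ↔ t = c) ∧
      (∀ s, s ≠ c → ∃ ω : EndTD.VertexEnd G, EndTD.IsTopologicalEnd ω ∧ Q.LivesInPart ω s) ∧
      (∀ s, s ≠ c → (G.induce ((Q.part s).verts \ (Q.part c).verts)).Connected) := by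
  -- Enveloping the closed neighbourhood rather than `W` keeps `W` out of the boundaries of the
  -- components too.
  obtain ⟨E, hAE, hnear, hfin⟩ := exists_envelope (G := G) {x | ∃ w ∈ W, x = w ∨ G.Adj x w}
  let 𝒞 : Set (Set V) := {C | (∃ a, a ∉ E ∧ C = component G E a) ∧
    ∃ ω : VertexEnd G, IsTopologicalEnd ω ∧ ∃ R : Ray G, R.BelongsTo ω ∧ ∀ n, R.vert n ∈ C}
  have hCE : ∀ C ∈ 𝒞, ∀ x ∈ C, x ∉ E := by
    rintro _ ⟨⟨a, -, rfl⟩, -⟩ x hx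
    exact hx.right_notMem
  have hd : 𝒞.PairwiseDisjoint id := by
    rintro _ ⟨⟨a, -, rfl⟩, -⟩ _ ⟨⟨b, -, rfl⟩, -⟩ hne
    refine Set.disjoint_left.2 fun x hx hx' => hne ?_
    have hab : Linked G E a b := hx.trans hx'.symm
    ext y
    exact ⟨fun hy => hab.symm.trans hy, fun hy => hab.trans hy⟩
  have hbE : ∀ C ∈ 𝒞, boundary G C ⊆ E := by
    rintro _ ⟨⟨a, -, rfl⟩, -⟩
    exact boundary_component_subset
  have hb : ∀ C ∈ 𝒞, Disjoint (boundary G C) (⋃₀ 𝒞) := fun C hC =>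
    Set.disjoint_left.2 fun x hx ⟨D, hD, hxD⟩ => hCE D hD x hxD (hbE C hC hx)
  have hbfin : ∀ C ∈ 𝒞, (boundary G C).Finite := by
    rintro _ ⟨⟨a, ha, rfl⟩, -⟩
    exact hfin a ha
  have hWC : ∀ w ∈ W, ∀ C ∈ 𝒞, w ∉ C ∪ boundary G C := by
    rintro w hw C hC (hx | ⟨-, y, hy, hxy⟩)
    · exact hCE C hC w hx (hAE ⟨w, hw, Or.inl rfl⟩)
    · exact hCE C hC y hy (hAE ⟨w, hw, Or.inr hxy.symm⟩)
  have hdiff : ∀ C : 𝒞, (C.1 ∪ boundary G C) \ (⋃₀ 𝒞)ᶜ = C.1 := by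
    intro C
    ext x
    constructor
    · rintro ⟨hx | hx, hx'⟩
      · exact hx
      · exact (hx' (Set.disjoint_left.1 (hb C C.2) hx)).elim
    · exact fun hx => ⟨Or.inl hx, fun hx' => hx' ⟨C, C.2, hx⟩⟩
  have hadh : ∀ C : 𝒞, ((C.1 ∪ boundary G C) ∩ (⋃₀ 𝒞)ᶜ).Finite := fun C =>
    (hbfin C C.2).subset fun x ⟨hx, hx'⟩ => hx.resolve_left fun h => hx' ⟨C, C.2, h⟩
  refine ⟨Option 𝒞, none, starDecomposition G 𝒞 hd hb, rfl, ?_, ?_, ?_, ?_, ?_⟩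
  · intro t r htr
    have hadj : (SimpleGraph.starGraph (none : Option 𝒞)).Adj t r := htr
    rw [SimpleGraph.starGraph_adj] at hadj
    rcases t with _ | C <;> rcases r with _ | D
    · exact (hadj.1 rfl).elim
    · rw [Set.inter_comm]
      exact hadh D
    · exact hadh C
    · simp at hadj
  · intro ω hω
    obtain ⟨R, hR⟩ := Quotient.exists_rep ω
    -- A finite `X` thus separates `R` from `E`, so `R` avoids `E` once it has left `X` for good.
    have hRE : ¬ Near R E := fun h => hω.not_near hR hWfin (hnear R h)
    simp only [Near] at hRE
    push Not at hRE
    obtain ⟨X, hX, hXR⟩ := hRE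
    obtain ⟨N, hN⟩ := R.exists_forall_notMem hX
    have hE : ∀ k, N ≤ k → R.vert k ∉ E := fun k hk hkE =>
      hXR k _ hkE (.refl (hN k hk))
    have hC : component G E (R.vert N) ∈ 𝒞 :=
      ⟨⟨_, hE N le_rfl, rfl⟩, ω, hω, R.tail N, Ray.tail_belongsTo hR N, fun n =>
        R.linked_of_le (Nat.le_add_left N n) hE⟩
    exact ⟨some ⟨_, hC⟩, by simp, starDecomposition_livesInPart hd hb
      (Ray.tail_belongsTo hR N) ⟨_, hC⟩ (hbfin _ hC)
      fun n => R.linked_of_le (Nat.le_add_left N n) hE⟩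
  · rintro w hw (_ | C)
    · exact ⟨fun _ => rfl, fun _ ⟨C, hC, hwC⟩ => hWC w hw C hC (Or.inl hwC)⟩
    · exact ⟨fun h => (hWC w hw C C.2 h).elim, fun h => by simp at h⟩
  · rintro (_ | C) hs
    · exact (hs rfl).elim
    · obtain ⟨-, ω, hω, R, hR, hRC⟩ := C.2
      exact ⟨ω, hω, starDecomposition_livesInPart hd hb hR C (hbfin C C.2) hRC⟩
  · rintro (_ | C) hs
    · exact (hs rfl).elim
    · change (G.induce ((C.1 ∪ boundary G C) \ (⋃₀ 𝒞)ᶜ)).Connected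
      rw [hdiff]
      obtain ⟨⟨a, ha, hCa⟩, -⟩ := C.2
      rw [hCa]
      exact component_connected ha
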